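/- Let $\Gamma$ be a countable group with a proper left-invariant distance $d$ (every ball is finite), and write $|g|=d(g,e)$. Let $\mu$ be a symmetric probability measure on $\Gamma$ (that is, $\mu(g^{-1})=\mu(g)$ for all $g$) with finite first moment $\sum_g |g|\,\mu(g)<\infty$. Let $\mu^{*n}$ be the $n$-fold convolution of $\mu$, and for $p\ge 1$ put $M_p(\mu)=\bigl(\sum_g |g|^p\mu(g)\bigr)^{1/p}\in[0,\infty]$. Then the drift and the asymptotic entropy $$\ell=\lim_{n\to\infty}\frac1n\sum_g |g|\,\mu^{*n}(g)\in[0,\infty),\qquad h=\lim_{n\to\infty}-\frac1n\sum_g \mu^{*n}(g)\log\mu^{*n}(g)\in[0,\infty]$$ exist, and $$\sum_{n=1}^{\infty}\frac{2}{2n-1}\left(\frac{\ell}{M_{1+1/(2n-1)}(\mu)}\right)^{2n}\le h ,$$ where a term whose moment $M_{1+1/(2n-1)}(\mu)$ is infinite is read as $0$, and $0/0$ is read as $0$ (this occurs only for $\mu=\delta_e$). This strengthens the inequality $2\tilde\ell\,\operatorname{artanh}\tilde\ell\le h$, where $\tilde\ell=\ell/M_2(\mu)$: if $M_2(\mu)<\infty$,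 then $\tilde\ell<1$ and $$2\tilde\ell\,\operatorname{artanh}\tilde\ell\le\sum_{n=1}^{\infty}\frac{2}{2n-1}\left(\frac{\ell}{M_{1+1/(2n-1)}(\mu)}\right)^{2n}.$$ -/

import Mathlib

open Filter Topology
open scoped ENNReal

namespace GroupWalk

noncomputable section

/-- The `n`-fold convolution `μ^{*n}`: the law of `X_n = γ₁ ⋯ γ_n` for independent
`μ`-distributed `γ_i`, with `X_0` the identity. -/
def convPow {Γ : Type*} [Group Γ] (μ : PMF Γ) : ℕ → PMF Γ
  | 0 => PMF.pure 1
  | n + 1 => (convPow μ n).bind fun x => μ.map fun y => x * y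

/-- The Shannon entropy `-∑ ν(g) log ν(g)`, a sum of nonnegative terms, with value in `[0, ∞]`. -/
def entropy {Γ : Type*} (ν : PMF Γ) : ℝ≥0∞ :=
  ∑' g, ENNReal.ofReal (Real.negMulLog (ν g).toReal)

/-- The mean distance to the identity `∑ |g| ν(g)`, with value in `[0, ∞]`. -/
def meanLength {Γ : Type*} [Group Γ] [MetricSpace Γ] (ν : PMF Γ) : ℝ≥0∞ :=
  ∑' g, ENNReal.ofReal (dist g 1) * ν g

/-- `M_p(ν) = (∑ |g|^p ν(g))^{1/p}`, with value in `[0, ∞]`. -/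
def pMoment {Γ : Type*} [Group Γ] [MetricSpace Γ] (p : ℝ) (ν : PMF Γ) : ℝ≥0∞ :=
  (∑' g, ENNReal.ofReal (dist g 1 ^ p) * ν g) ^ (1 / p)

/-- The asymptotic entropy `h = lim H(μ^{*n}) / n`. -/
def asympEntropy {Γ : Type*} [Group Γ] (μ : PMF Γ) : ℝ≥0∞ :=
  limUnder atTop fun n : ℕ => entropy (convPow μ n) / (n : ℝ≥0∞)

/-- The drift `ℓ = lim (1/n) ∑ |g| μ^{*n}(g)`. -/
def drift {Γ : Type*} [Group Γ] [MetricSpace Γ] (μ : PMF Γ) : ℝ≥0∞ :=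
  limUnder atTop fun n : ℕ => meanLength (convPow μ n) / (n : ℝ≥0∞)

/-- The sum over `n ≥ 1` of `2 / (2n-1) * (ℓ / M_{1+1/(2n-1)}(μ))^{2n}`. In `[0, ∞]` the quotient
by an infinite moment is `0`, and so is `0 / 0`. -/
def driftSeries {Γ : Type*} [Group Γ] [MetricSpace Γ] (μ : PMF Γ) : ℝ≥0∞ :=
  ∑' n : ℕ+, ENNReal.ofReal (2 / (2 * (n : ℝ) - 1)) *
    (drift μ / pMoment (1 + 1 / (2 * (n : ℝ) - 1)) μ) ^ (2 * (n : ℕ))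

end

end GroupWalk

namespace GroupWalk

/-! Stop the walk at an independent geometric time `N` with weights `(1 - β) β ^ n`. The law `G` of
`X_N` satisfies `G = (1 - β) δ_e + β (G * μ)`, so it is almost stationary as `β → 1`. Let `x` have
law `G`, let `g` be an independent `μ`-step, and let `t = |G x - G (x g)| / (G x + G (x g))`. Both
sides of the inequality are compared with moments of `t`.

Entropy: since `μ` is symmetric, the mean increase of `-log G` along the step is half the sum of `μ
g (p - q) (log p - log q)` with `p = G x`, `q = G (x g)`. As `(p - q) (log p - log q) = (p + q) · 2
t artanh t`, expanding `artanh` shows that this increase equals `A = ∑ 2 / (2n - 1) · E[t ^ (2n)]`.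
The bound `β (G * μ) ≤ G` then gives `β A ≤ (1 - β) H(G)` (`tsum_relDiffMean_le`), and `(1 - β)
H(G)` is asymptotically at most `h`, because `E N = β / (1 - β)` and the geometric time itself has
negligible entropy (`entropy_geometricWalk_le`).

Drift: the same symmetrization bounds the mean increase of `|x|` by `E[t |g|]`. This increase is `(1
- β) E|X_{N+1}| ≥ ℓ`, since `E|X_n| ≥ n ℓ` (`drift_le_tsum_geometricWalk`). Hölder's inequality with
exponents `2n` and `2n / (2n - 1) = 1 + 1 / (2n - 1)` gives `(ℓ / M) ^ (2n) ≤ E[t ^ (2n)]` for each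
`n`. Summing and letting `β → 1` proves the theorem. -/

/-- The convolution of two laws on a group. -/
noncomputable def conv {Γ : Type*} [Group Γ] (P Q : PMF Γ) : PMF Γ :=
  P.bind fun x => Q.map fun y => x * y

/-- The information content `-log p`, with value in `[0, ∞)`; it is `0` at `p = 0`. -/
noncomputable def surprisal (p : ℝ≥0∞) : ℝ≥0∞ := ENNReal.ofReal (-Real.log p.toReal)

/-! ### Convolutions and expectations -/

section Sums

variable {α β : Type*}

lemma tsum_bind_mul (P : PMF α) (Q : α → PMF β) (f : β → ℝ≥0∞) :
    ∑' z, P.bind Q z * f z = ∑' x, P x * ∑' z, Q x z * f z := by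
  simp only [PMF.bind_apply, ← ENNReal.tsum_mul_right, ← ENNReal.tsum_mul_left]
  rw [ENNReal.tsum_comm]
  simp only [mul_assoc]

lemma tsum_map_mul (Q : PMF α) (φ : α → β) (f : β → ℝ≥0∞) :
    ∑' z, Q.map φ z * f z = ∑' y, Q y * f (φ y) := by
  rw [PMF.map, tsum_bind_mul]
  refine tsum_congr fun y => ?_
  congr 1
  rw [tsum_eq_single (φ y)]
  · simp
  · intro z hz
    simp [hz]

end Sums

section Conv

variable {Γ : Type*} [Group Γ]

lemma tsum_conv_mul (P Q : PMF Γ) (f : Γ → ℝ≥0∞) :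
    ∑' z, conv P Q z * f z = ∑' x, ∑' y, P x * Q y * f (x * y) := by
  simp only [conv, tsum_bind_mul, tsum_map_mul, ← ENNReal.tsum_mul_left, mul_assoc]

lemma conv_apply (P Q : PMF Γ) (z : Γ) : conv P Q z = ∑' x, P x * Q (x⁻¹ * z) := by
  rw [conv, PMF.bind_apply]
  refine tsum_congr fun x => ?_
  congr 1
  rw [PMF.map_apply, tsum_eq_single (x⁻¹ * z)]
  · simp
  · intro y hy
    rw [if_neg]
    rintro rfl
    simp at hy

lemma mul_le_conv (P Q : PMF Γ) (x y : Γ) : P x * Q y ≤ conv P Q (x * y) := by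
  rw [conv_apply]
  refine le_trans ?_ (ENNReal.le_tsum x)
  simp

lemma conv_assoc (P Q R : PMF Γ) : conv (conv P Q) R = conv P (conv Q R) := by
  simp only [conv, PMF.bind_bind, PMF.map_bind, PMF.bind_map, PMF.map_comp]
  simp only [Function.comp_def, mul_assoc]

lemma conv_pure_one (P : PMF Γ) : conv P (PMF.pure 1) = P := by
  simp [conv, PMF.pure_map]

lemma convPow_succ (μ : PMF Γ) (n : ℕ) : convPow μ (n + 1) = conv (convPow μ n) μ := rfl

lemma convPow_one (μ : PMF Γ) : convPow μ 1 = μ := by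
  simp only [convPow, PMF.pure_bind, one_mul]
  exact PMF.map_id μ

lemma convPow_add (μ : PMF Γ) (m n : ℕ) :
    convPow μ (m + n) = conv (convPow μ m) (convPow μ n) := by
  induction n with
  | zero => exact (conv_pure_one _).symm
  | succ n ih => rw [← add_assoc, convPow_succ, ih, conv_assoc, ← convPow_succ]

end Conv

/-! ### Information content -/

section Surprisal

lemma surprisal_ne_top (p : ℝ≥0∞) : surprisal p ≠ ∞ := ENNReal.ofReal_ne_top

lemma surprisal_anti {p q : ℝ≥0∞} (hp : p ≠ 0) (hpq : p ≤ q) (hq : q ≠ ∞) :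
    surprisal q ≤ surprisal p := by
  refine ENNReal.ofReal_le_ofReal (neg_le_neg (Real.log_le_log ?_ ?_))
  · exact ENNReal.toReal_pos hp (ne_top_of_le_ne_top hq hpq)
  · exact ENNReal.toReal_mono hq hpq

lemma surprisal_mul_le {p q : ℝ≥0∞} (hp : p ≠ 0) (hq : q ≠ 0) (hp' : p ≠ ∞) (hq' : q ≠ ∞) :
    surprisal (p * q) ≤ surprisal p + surprisal q := by
  rw [surprisal, ENNReal.toReal_mul, Real.log_mul (ENNReal.toReal_pos hp hp').ne'
    (ENNReal.toReal_pos hq hq').ne', neg_add]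
  exact ENNReal.ofReal_add_le

lemma surprisal_pow_le {p : ℝ≥0∞} (n : ℕ) : surprisal (p ^ n) ≤ n * surprisal p := by
  rw [surprisal, ENNReal.toReal_pow, Real.log_pow, ← mul_neg,
    ENNReal.ofReal_mul (Nat.cast_nonneg n), ENNReal.ofReal_natCast, surprisal]

/-- The information inequality for a pair of points. -/
lemma mul_surprisal_add_le {p q : ℝ≥0∞} (hp : p ≤ 1) (hq : q ≤ 1) (h : p ≠ 0 → q ≠ 0) :
    p * surprisal p + p ≤ p * surprisal q + q := by
  rcases eq_or_ne p 0 with rfl | hp0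
  · simp
  have hq0 := h hp0
  have hp' := ne_top_of_le_ne_top ENNReal.one_ne_top hp
  have hq' := ne_top_of_le_ne_top ENNReal.one_ne_top hq
  lift p to NNReal using hp'
  lift q to NNReal using hq'
  have hp1 : (p : ℝ) ≤ 1 := by exact_mod_cast hp
  have hq1 : (q : ℝ) ≤ 1 := by exact_mod_cast hq
  have hpp : (0 : ℝ) < p := by
    have : p ≠ 0 := by exact_mod_cast hp0
    positivity
  have hqp : (0 : ℝ) < q := by
    have : q ≠ 0 := by exact_mod_cast hq0
    positivity
  have hlp := Real.log_nonpos hpp.le hp1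
  have hlq := Real.log_nonpos hqp.le hq1
  have hlog : Real.log q - Real.log p ≤ q / p - 1 := by
    rw [← Real.log_div hqp.ne' hpp.ne']
    exact Real.log_le_sub_one_of_pos (by positivity)
  have key : (p : ℝ) * (-Real.log p) + p ≤ p * (-Real.log q) + q := by
    have := mul_le_mul_of_nonneg_left hlog hpp.le
    rw [mul_sub _ (q / p : ℝ), mul_div_cancel₀ _ hpp.ne'] at this
    linarith
  simp only [surprisal, ENNReal.coe_toReal]
  rw [← ENNReal.ofReal_coe_nnreal, ← ENNReal.ofReal_coe_nnreal (p := q),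
    ← ENNReal.ofReal_mul hpp.le, ← ENNReal.ofReal_mul hpp.le,
    ← ENNReal.ofReal_add (mul_nonneg hpp.le (by linarith)) hpp.le,
    ← ENNReal.ofReal_add (mul_nonneg hpp.le (by linarith)) hqp.le]
  exact ENNReal.ofReal_le_ofReal key

lemma entropy_eq_tsum {Γ : Type*} (ν : PMF Γ) : entropy ν = ∑' g, ν g * surprisal (ν g) := by
  refine tsum_congr fun g => ?_
  rw [surprisal, Real.negMulLog, neg_mul_comm, ENNReal.ofReal_mul ENNReal.toReal_nonneg,
    ENNReal.ofReal_toReal (ν.apply_ne_top g)]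

end Surprisal

/-! ### Entropy and mean length under convolution -/

section Subadditivity

variable {Γ : Type*} [Group Γ]

/-- The atom of the convolution at `x * y` is at least `P x * Q y`, so its surprisal is at most the
sum of the two surprisals; average over independent `x`, `y`. -/
lemma entropy_conv_le (P Q : PMF Γ) : entropy (conv P Q) ≤ entropy P + entropy Q := by
  have h1 : ∑' x, ∑' y, P x * Q y * surprisal (P x) = entropy P := by
    rw [entropy_eq_tsum]
    refine tsum_congr fun x => ?_
    rw [ENNReal.tsum_mul_right, ENNReal.tsum_mul_left, Q.tsum_coe, mul_one]
  have h2 : ∑' x, ∑' y, P x * Q y * surprisal (Q y) = entropy Q := by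
    simp_rw [mul_assoc, ENNReal.tsum_mul_left, ENNReal.tsum_mul_right, P.tsum_coe, one_mul,
      entropy_eq_tsum]
  rw [entropy_eq_tsum (conv P Q), tsum_conv_mul, ← h1, ← h2, ← ENNReal.tsum_add]
  refine ENNReal.tsum_le_tsum fun x => ?_
  rw [← ENNReal.tsum_add]
  refine ENNReal.tsum_le_tsum fun y => ?_
  rw [← mul_add]
  rcases eq_or_ne (P x) 0 with hx | hx
  · simp [hx]
  rcases eq_or_ne (Q y) 0 with hy | hy
  · simp [hy]
  gcongr
  exact (surprisal_anti (mul_ne_zero hx hy) (mul_le_conv P Q x y) (PMF.apply_ne_top _ _)).trans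
    (surprisal_mul_le hx hy (P.apply_ne_top x) (Q.apply_ne_top y))

/-- For fixed `x`, Gibbs' inequality compares `Q` with the translate `y ↦ conv P Q (x * y)`; then
average over `P`. The total mass `1` is added on both sides to avoid subtraction in `[0, ∞]`. This
settles the case of infinite `entropy μ`. -/
lemma entropy_le_entropy_conv (P Q : PMF Γ) : entropy Q ≤ entropy (conv P Q) := by
  have h : entropy Q + 1 ≤ entropy (conv P Q) + 1 := by
    have h1 : ∑' x, P x * ∑' y, conv P Q (x * y) = 1 := by
      have : ∀ x, ∑' y, conv P Q (x * y) = 1 := fun x => by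
        rw [← (conv P Q).tsum_coe]
        exact (Equiv.mulLeft x).tsum_eq (conv P Q)
      simp [this, P.tsum_coe]
    calc entropy Q + 1 = ∑' x, P x * (entropy Q + 1) := by
          rw [ENNReal.tsum_mul_right, P.tsum_coe, one_mul]
      _ ≤ ∑' x, P x * ∑' y, (Q y * surprisal (conv P Q (x * y)) + conv P Q (x * y)) := by
          refine ENNReal.tsum_le_tsum fun x => ?_
          rcases eq_or_ne (P x) 0 with hx | hx
          · simp [hx]
          gcongr
          rw [entropy_eq_tsum, ← Q.tsum_coe, ← ENNReal.tsum_add]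
          refine ENNReal.tsum_le_tsum fun y => ?_
          refine mul_surprisal_add_le (PMF.coe_le_one _ _) (PMF.coe_le_one _ _) fun hy h0 => ?_
          have := mul_le_conv P Q x y
          rw [h0] at this
          exact mul_ne_zero hx hy (nonpos_iff_eq_zero.1 this)
      _ = entropy (conv P Q) + 1 := by
          rw [entropy_eq_tsum (conv P Q), tsum_conv_mul, ← h1, ← ENNReal.tsum_add]
          refine tsum_congr fun x => ?_
          rw [ENNReal.tsum_add, mul_add, ← ENNReal.tsum_mul_left]
          simp only [mul_assoc]
  exact (ENNReal.add_le_add_iff_right ENNReal.one_ne_top).1 h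

lemma entropy_pure {α : Type*} (g : α) : entropy (PMF.pure g) = 0 := by
  classical
  rw [entropy, ENNReal.tsum_eq_zero]
  intro x
  by_cases h : x = g <;> simp [PMF.pure_apply, h]

variable [MetricSpace Γ]

lemma meanLength_pure_one : meanLength (PMF.pure (1 : Γ)) = 0 := by
  classical
  rw [meanLength, ENNReal.tsum_eq_zero]
  intro x
  by_cases h : x = 1 <;> simp [PMF.pure_apply, h]

lemma dist_mul_one_le (hleft : ∀ a x y : Γ, dist (a * x) (a * y) = dist x y) (x y : Γ) :
    dist (x * y) 1 ≤ dist x 1 + dist y 1 := by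
  have h := hleft x y 1
  rw [mul_one] at h
  linarith [dist_triangle (x * y) x 1]

lemma dist_one_le (hleft : ∀ a x y : Γ, dist (a * x) (a * y) = dist x y) (x y : Γ) :
    dist x 1 ≤ dist (x * y) 1 + dist y 1 := by
  have h := hleft x y 1
  rw [mul_one, dist_comm] at h
  linarith [dist_triangle x (x * y) 1]

lemma meanLength_conv (P Q : PMF Γ) : meanLength (conv P Q) =
    ∑' x, ∑' y, P x * Q y * ENNReal.ofReal (dist (x * y) 1) := by
  simp only [meanLength, mul_comm (ENNReal.ofReal _), tsum_conv_mul]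

lemma meanLength_conv_le (hleft : ∀ a x y : Γ, dist (a * x) (a * y) = dist x y) (P Q : PMF Γ) :
    meanLength (conv P Q) ≤ meanLength P + meanLength Q := by
  have h1 : ∑' x, ∑' y, P x * Q y * ENNReal.ofReal (dist x 1) = meanLength P := by
    rw [meanLength]
    refine tsum_congr fun x => ?_
    rw [ENNReal.tsum_mul_right, ENNReal.tsum_mul_left, Q.tsum_coe, mul_one, mul_comm]
  have h2 : ∑' x, ∑' y, P x * Q y * ENNReal.ofReal (dist y 1) = meanLength Q := by
    simp_rw [mul_assoc, ENNReal.tsum_mul_left, ENNReal.tsum_mul_right, P.tsum_coe, one_mul,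
      meanLength, mul_comm]
  rw [meanLength_conv, ← h1, ← h2, ← ENNReal.tsum_add]
  refine ENNReal.tsum_le_tsum fun x => ?_
  rw [← ENNReal.tsum_add]
  refine ENNReal.tsum_le_tsum fun y => ?_
  rw [← mul_add, ← ENNReal.ofReal_add dist_nonneg dist_nonneg]
  gcongr
  exact dist_mul_one_le hleft x y

end Subadditivity

/-! ### Existence of the drift and the asymptotic entropy -/

/-- Fekete's lemma for a finite subadditive sequence with values in `[0, ∞]`. -/
lemma exists_tendsto_div_of_subadditive {u : ℕ → ℝ≥0∞} (hadd : ∀ m n, u (m + n) ≤ u m + u n)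
    (hfin : ∀ n, u n ≠ ∞) : ∃ l : ℝ≥0∞, l ≠ ∞ ∧
      Tendsto (fun n : ℕ => u n / (n : ℝ≥0∞)) atTop (𝓝 l) ∧ ∀ n : ℕ, n * l ≤ u n := by
  have hsub : Subadditive fun n => (u n).toReal := fun m n => by
    rw [← ENNReal.toReal_add (hfin m) (hfin n)]
    exact ENNReal.toReal_mono (ENNReal.add_ne_top.2 ⟨hfin m, hfin n⟩) (hadd m n)
  have hbdd : BddBelow (Set.range fun n : ℕ => (u n).toReal / n) :=
    ⟨0, by rintro _ ⟨n, rfl⟩; positivity⟩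
  refine ⟨ENNReal.ofReal hsub.lim, ENNReal.ofReal_ne_top, ?_, fun n => ?_⟩
  · refine (ENNReal.tendsto_ofReal (hsub.tendsto_lim hbdd)).congr' ?_
    filter_upwards [eventually_gt_atTop 0] with n hn
    rw [ENNReal.ofReal_div_of_pos (by positivity), ENNReal.ofReal_toReal (hfin n),
      ENNReal.ofReal_natCast]
  -- The Fekete limit is the infimum of `u n / n`.
  · rcases Nat.eq_zero_or_pos n with rfl | hn
    · simp
    · have hn' : (0 : ℝ) < n := by positivity
      have := hsub.lim_le_div hbdd hn.ne'
      rw [le_div_iff₀ hn', mul_comm] at this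
      calc (n : ℝ≥0∞) * ENNReal.ofReal hsub.lim = ENNReal.ofReal (n * hsub.lim) := by
            rw [ENNReal.ofReal_mul hn'.le, ENNReal.ofReal_natCast]
        _ ≤ ENNReal.ofReal (u n).toReal := ENNReal.ofReal_le_ofReal this
        _ = u n := ENNReal.ofReal_toReal (hfin n)

section Limits

variable {Γ : Type*} [Group Γ]

lemma entropy_convPow_ne_top {μ : PMF Γ} (h : entropy μ ≠ ∞) (n : ℕ) :
    entropy (convPow μ n) ≠ ∞ := by
  induction n with
  | zero => simp [convPow, entropy_pure]
  | succ n ih => exact ne_top_of_le_ne_top (ENNReal.add_ne_top.2 ⟨ih, h⟩) (entropy_conv_le _ _)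

lemma asympEntropy_of_entropy_eq_top {μ : PMF Γ} (h : entropy μ = ∞) :
    Tendsto (fun n : ℕ => entropy (convPow μ n) / (n : ℝ≥0∞)) atTop (𝓝 (asympEntropy μ)) ∧
      asympEntropy μ = ∞ := by
  have ht : Tendsto (fun n : ℕ => entropy (convPow μ n) / (n : ℝ≥0∞)) atTop (𝓝 ∞) := by
    refine tendsto_const_nhds.congr' ?_
    filter_upwards [eventually_gt_atTop 0] with n hn
    obtain ⟨m, rfl⟩ := Nat.exists_eq_succ_of_ne_zero hn.ne'
    have : entropy (convPow μ (m + 1)) = ∞ := by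
      rw [convPow_succ]
      exact top_le_iff.1 (h ▸ entropy_le_entropy_conv _ _)
    rw [this, ENNReal.top_div_of_ne_top (ENNReal.natCast_ne_top _)]
  have he : asympEntropy μ = ∞ := ht.limUnder_eq
  exact ⟨he ▸ ht, he⟩

lemma tendsto_asympEntropy (μ : PMF Γ) :
    Tendsto (fun n : ℕ => entropy (convPow μ n) / (n : ℝ≥0∞)) atTop (𝓝 (asympEntropy μ)) := by
  by_cases h : entropy μ = ∞
  · exact (asympEntropy_of_entropy_eq_top h).1
  obtain ⟨l, -, hl, -⟩ := exists_tendsto_div_of_subadditive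
    (u := fun n => entropy (convPow μ n)) (fun m n => by
      rw [convPow_add]; exact entropy_conv_le _ _) (entropy_convPow_ne_top h)
  exact tendsto_nhds_limUnder ⟨l, hl⟩

variable [MetricSpace Γ]

lemma meanLength_convPow_ne_top (hleft : ∀ a x y : Γ, dist (a * x) (a * y) = dist x y)
    {μ : PMF Γ} (h : meanLength μ ≠ ∞) (n : ℕ) : meanLength (convPow μ n) ≠ ∞ := by
  induction n with
  | zero => simp [convPow, meanLength_pure_one]
  | succ n ih =>
    exact ne_top_of_le_ne_top (ENNReal.add_ne_top.2 ⟨ih, h⟩) (meanLength_conv_le hleft _ _)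

lemma drift_spec (hleft : ∀ a x y : Γ, dist (a * x) (a * y) = dist x y)
    {μ : PMF Γ} (h : meanLength μ ≠ ∞) : drift μ ≠ ∞ ∧
      Tendsto (fun n : ℕ => meanLength (convPow μ n) / (n : ℝ≥0∞)) atTop (𝓝 (drift μ)) ∧
      ∀ n : ℕ, n * drift μ ≤ meanLength (convPow μ n) := by
  obtain ⟨l, h1, h2, h3⟩ := exists_tendsto_div_of_subadditive
    (u := fun n => meanLength (convPow μ n)) (fun m n => by
      rw [convPow_add]; exact meanLength_conv_le hleft _ _) (meanLength_convPow_ne_top hleft h)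
  have : drift μ = l := h2.limUnder_eq
  rw [this]
  exact ⟨h1, h2, h3⟩

end Limits

/-! ### The relative difference and the `artanh` series -/

/-- The relative difference `|p - q| / (p + q)`. -/
noncomputable def relDiff (p q : ℝ≥0∞) : ℝ≥0∞ :=
  ENNReal.ofReal (|p.toReal - q.toReal| / (p.toReal + q.toReal))

lemma relDiff_comm (p q : ℝ≥0∞) : relDiff p q = relDiff q p := by
  rw [relDiff, relDiff, abs_sub_comm, add_comm]

/-- The power series of `x ↦ x (log (1 + x) - log (1 - x)) = 2 x artanh x`. -/
lemma hasSum_mul_log_sub_log {x : ℝ} (hx : |x| < 1) :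
    HasSum (fun n : ℕ+ => 2 / (2 * (n : ℝ) - 1) * x ^ (2 * (n : ℕ)))
      (x * (Real.log (1 + x) - Real.log (1 - x))) := by
  have h := (Real.hasSum_log_sub_log_of_abs_lt_one hx).mul_left x
  rw [← Equiv.pnatEquivNat.hasSum_iff] at h
  refine h.congr_fun fun n => ?_
  obtain ⟨k, rfl⟩ := Equiv.pnatEquivNat.symm.surjective n
  simp only [Function.comp_apply, Equiv.pnatEquivNat_symm_apply, Equiv.pnatEquivNat_apply,
    Nat.natPred_succPNat, Nat.succPNat_coe, Nat.succ_eq_add_one]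
  push_cast
  rw [show 2 * ((k : ℝ) + 1) - 1 = 2 * k + 1 by ring, show 2 * (k + 1) = 2 * k + 1 + 1 by ring,
    pow_succ]
  ring

lemma two_div_nonneg (n : ℕ+) : 0 ≤ 2 / (2 * (n : ℝ) - 1) := by
  have : (1 : ℝ) ≤ (n : ℕ) := by exact Nat.one_le_cast.2 n.pos
  exact div_nonneg zero_le_two (by linarith)

lemma tsum_mul_pow_eq {x : ℝ} (hx0 : 0 ≤ x) (hx : x < 1) :
    ∑' n : ℕ+, ENNReal.ofReal (2 / (2 * (n : ℝ) - 1)) * ENNReal.ofReal x ^ (2 * (n : ℕ)) =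
      ENNReal.ofReal (x * (Real.log (1 + x) - Real.log (1 - x))) := by
  have h := hasSum_mul_log_sub_log (x := x) (by rwa [abs_of_nonneg hx0])
  rw [← h.tsum_eq, ENNReal.ofReal_tsum_of_nonneg (fun n => by
    have := two_div_nonneg n; positivity) h.summable]
  refine tsum_congr fun n => ?_
  rw [ENNReal.ofReal_mul (two_div_nonneg n), ENNReal.ofReal_pow hx0]

/-- The symmetrized information inequality is an identity of power series. -/
lemma tsum_relDiff_add {p q : ℝ≥0∞} (hp : p ≤ 1) (hq : q ≤ 1) (h : p = 0 ↔ q = 0) :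
    ∑' n : ℕ+, ENNReal.ofReal (2 / (2 * (n : ℝ) - 1)) * ((p + q) * relDiff p q ^ (2 * (n : ℕ))) +
      (p * surprisal p + q * surprisal q) = p * surprisal q + q * surprisal p := by
  rcases eq_or_ne p 0 with rfl | hp0
  · simp [h.1 rfl]
  have hq0 := fun h0 => hp0 (h.2 h0)
  have hp' := ne_top_of_le_ne_top ENNReal.one_ne_top hp
  have hq' := ne_top_of_le_ne_top ENNReal.one_ne_top hq
  lift p to NNReal using hp'
  lift q to NNReal using hq'
  have hp1 : (p : ℝ) ≤ 1 := by exact_mod_cast hp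
  have hq1 : (q : ℝ) ≤ 1 := by exact_mod_cast hq
  have hpp : (0 : ℝ) < p := by
    have : p ≠ 0 := by exact_mod_cast hp0
    positivity
  have hqp : (0 : ℝ) < q := by
    have : q ≠ 0 := by exact_mod_cast hq0
    positivity
  have hlp := Real.log_nonpos hpp.le hp1
  have hlq := Real.log_nonpos hqp.le hq1
  have hs : (0 : ℝ) < p + q := by positivity
  set t : ℝ := |(p : ℝ) - q| / (p + q) with ht
  have ht0 : 0 ≤ t := by positivity
  have ht1 : t < 1 := by
    rw [ht, div_lt_one hs, abs_lt]
    constructor <;> linarith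
  -- For `t = (a - b) / (a + b)` one has `(1 + t) / (1 - t) = a / b`; the absolute value only
  -- exchanges `p` and `q`.
  have key : ((p : ℝ) + q) * (t * (Real.log (1 + t) - Real.log (1 - t))) =
      (p - q) * (Real.log p - Real.log q) := by
    have hlog : ∀ a b : ℝ, 0 < a → 0 < b → Real.log (1 + (a - b) / (a + b)) -
        Real.log (1 - (a - b) / (a + b)) = Real.log a - Real.log b := fun a b ha hb => by
      have hab : a + b ≠ 0 := by positivity
      rw [show 1 + (a - b) / (a + b) = 2 * a / (a + b) by field_simp; ring,
        show 1 - (a - b) / (a + b) = 2 * b / (a + b) by field_simp; ring,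
        Real.log_div (by positivity) hab, Real.log_div (by positivity) hab,
        Real.log_mul two_ne_zero ha.ne', Real.log_mul two_ne_zero hb.ne']
      ring
    rw [← mul_assoc, ht, mul_div_cancel₀ _ hs.ne']
    rcases abs_cases ((p : ℝ) - q) with ⟨h1, -⟩ | ⟨h1, -⟩
    · rw [h1, hlog p q hpp hqp]
    · rw [h1, neg_sub, add_comm (p : ℝ) q, hlog q p hqp hpp]
      ring
  have hr : relDiff p q = ENNReal.ofReal t := rfl
  have hsum : ((p : ℝ≥0∞) + q) = ENNReal.ofReal (p + q) := by
    rw [ENNReal.ofReal_add hpp.le hqp.le, ENNReal.ofReal_coe_nnreal, ENNReal.ofReal_coe_nnreal]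
  simp_rw [mul_left_comm _ ((p : ℝ≥0∞) + q)]
  rw [ENNReal.tsum_mul_left, hr, tsum_mul_pow_eq ht0 ht1, hsum, ← ENNReal.ofReal_mul hs.le, key]
  simp only [surprisal, ENNReal.coe_toReal]
  have e1 : (0 : ℝ) ≤ (p - q) * (Real.log p - Real.log q) := by
    rw [← key]
    have : 0 ≤ Real.log (1 + t) - Real.log (1 - t) :=
      sub_nonneg.2 (Real.log_le_log (by linarith) (by linarith))
    positivity
  rw [← ENNReal.ofReal_coe_nnreal, ← ENNReal.ofReal_coe_nnreal (p := q)]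
  have a1 : (0 : ℝ) ≤ p * -Real.log p := mul_nonneg hpp.le (by linarith)
  have a2 : (0 : ℝ) ≤ q * -Real.log q := mul_nonneg hqp.le (by linarith)
  have a3 : (0 : ℝ) ≤ p * -Real.log q := mul_nonneg hpp.le (by linarith)
  have a4 : (0 : ℝ) ≤ q * -Real.log p := mul_nonneg hqp.le (by linarith)
  rw [← ENNReal.ofReal_mul hpp.le, ← ENNReal.ofReal_mul hpp.le, ← ENNReal.ofReal_mul hqp.le,
    ← ENNReal.ofReal_mul hqp.le, ← ENNReal.ofReal_add a1 a2, ← ENNReal.ofReal_add a3 a4,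
    ← ENNReal.ofReal_add e1 (add_nonneg a1 a2)]
  congr 1
  ring

lemma add_mul_relDiff {p q : ℝ≥0∞} (hp : p ≠ ∞) (hq : q ≠ ∞) :
    (p + q) * relDiff p q = ENNReal.ofReal |p.toReal - q.toReal| := by
  rw [relDiff, ← ENNReal.toReal_add hp hq]
  rcases eq_or_ne (p + q) 0 with h | h
  · obtain ⟨rfl, rfl⟩ := add_eq_zero.1 h
    simp
  · have h' := ENNReal.toReal_pos h (ENNReal.add_ne_top.2 ⟨hp, hq⟩)
    nth_rewrite 1 [← ENNReal.ofReal_toReal (ENNReal.add_ne_top.2 ⟨hp, hq⟩)]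
    rw [← ENNReal.ofReal_mul h'.le, mul_div_cancel₀ _ h'.ne']

/-! ### One random step: entropy, length and Hölder's inequality -/

section Core

variable {Γ : Type*} [Group Γ]

/-- The mean of the `k`-th power of the relative difference of `G` at the ends of a random step. -/
noncomputable def relDiffMean (G μ : PMF Γ) (k : ℕ) : ℝ≥0∞ :=
  ∑' x, ∑' g, G x * μ g * relDiff (G x) (G (x * g)) ^ k

/-- Reversibility of the counting measure for right multiplication by symmetric increments. -/
lemma tsum_step_swap {μ : PMF Γ} (hsymm : ∀ g : Γ, μ g⁻¹ = μ g) (f : Γ → Γ → Γ → ℝ≥0∞)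
    (hf : ∀ x y g, f x y g⁻¹ = f x y g) :
    ∑' x, ∑' g, μ g * f x (x * g) g = ∑' x, ∑' g, μ g * f (x * g) x g := by
  -- Replace `g` by `g⁻¹`, then translate `x` by `g` on the right.
  rw [ENNReal.tsum_comm, ENNReal.tsum_comm (f := fun x g => μ g * f (x * g) x g),
    ← (Equiv.inv Γ).tsum_eq]
  refine tsum_congr fun g => ?_
  rw [← (Equiv.mulRight g).tsum_eq]
  simp [hsymm, hf]

lemma relDiffMean_add {G μ : PMF Γ} (hsymm : ∀ g : Γ, μ g⁻¹ = μ g) (φ : Γ → ℝ≥0∞)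
    (hφ : ∀ g, φ g⁻¹ = φ g) (k : ℕ) :
    ∑' x, ∑' g, μ g * ((G x + G (x * g)) * relDiff (G x) (G (x * g)) ^ k * φ g) =
      2 * ∑' x, ∑' g, G x * μ g * relDiff (G x) (G (x * g)) ^ k * φ g := by
  have h := tsum_step_swap hsymm (fun x y g => G x * relDiff (G x) (G y) ^ k * φ g)
    (fun x y g => by rw [hφ])
  have e : ∑' x, ∑' g, G x * μ g * relDiff (G x) (G (x * g)) ^ k * φ g =
      ∑' x, ∑' g, μ g * (G x * relDiff (G x) (G (x * g)) ^ k * φ g) := by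
    refine tsum_congr fun x => tsum_congr fun g => by ring
  rw [e, two_mul]
  nth_rewrite 2 [h]
  rw [← ENNReal.tsum_add]
  refine tsum_congr fun x => ?_
  rw [← ENNReal.tsum_add]
  refine tsum_congr fun g => ?_
  rw [relDiff_comm (G (x * g))]
  ring

/-- With `T` the cross entropy of `conv G μ` relative to `G`, symmetrization gives the exact
identity `A + entropy G = T`, and `hG` gives `b * T ≤ entropy G`. No finiteness is needed in this
form. -/
lemma tsum_relDiffMean_le {G μ : PMF Γ} (hsymm : ∀ g : Γ, μ g⁻¹ = μ g) {b : ℝ≥0∞} (hb : b ≠ 0)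
    (hG : ∀ y, b * conv G μ y ≤ G y) :
    b * (∑' n : ℕ+, ENNReal.ofReal (2 / (2 * (n : ℝ) - 1)) * relDiffMean G μ (2 * (n : ℕ)) +
      entropy G) ≤ entropy G := by
  set A := ∑' n : ℕ+, ENNReal.ofReal (2 / (2 * (n : ℝ) - 1)) * relDiffMean G μ (2 * (n : ℕ))
    with hA
  set T := ∑' x, ∑' g, μ g * (G x * surprisal (G (x * g))) with hT
  have hT' : T = ∑' x, ∑' g, μ g * (G (x * g) * surprisal (G x)) :=
    tsum_step_swap hsymm (fun x y _ => G x * surprisal (G y)) (fun _ _ _ => rfl)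
  have hH : entropy G = ∑' x, ∑' g, μ g * (G x * surprisal (G x)) := by
    rw [entropy_eq_tsum]
    refine tsum_congr fun x => ?_
    rw [ENNReal.tsum_mul_right, μ.tsum_coe, one_mul]
  have hH' : entropy G = ∑' x, ∑' g, μ g * (G (x * g) * surprisal (G (x * g))) := by
    rw [hH]
    exact (tsum_step_swap hsymm (fun x y _ => G y * surprisal (G y)) (fun _ _ _ => rfl)).symm
  have hbT : b * T ≤ entropy G := by
    have : T = ∑' y, conv G μ y * surprisal (G y) := by
      rw [tsum_conv_mul, hT]
      exact tsum_congr fun x => tsum_congr fun g => by ring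
    rw [this, entropy_eq_tsum, ← ENNReal.tsum_mul_left]
    refine ENNReal.tsum_le_tsum fun y => ?_
    rw [← mul_assoc]
    gcongr
    exact hG y
  have hle : ∀ x g, b * (G x * μ g) ≤ G (x * g) := fun x g =>
    (mul_le_mul_right (mul_le_conv G μ x g) b).trans (hG _)
  -- The support of `G` is invariant under the steps of `μ`, so no logarithm of `0` meets a positive
  -- weight, where `surprisal 0 = 0` would be the wrong value.
  have hiff : ∀ x g, μ g ≠ 0 → (G x = 0 ↔ G (x * g) = 0) := fun x g hg => by
    constructor
    · intro h
      have := hle (x * g) g⁻¹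
      rw [mul_inv_cancel_right, h, hsymm, nonpos_iff_eq_zero] at this
      simpa [hb, hg] using this
    · intro h
      have := hle x g
      rw [h, nonpos_iff_eq_zero] at this
      simpa [hb, hg] using this
  have h2A : 2 * A = ∑' x, ∑' g, μ g * ∑' n : ℕ+, ENNReal.ofReal (2 / (2 * (n : ℝ) - 1)) *
      ((G x + G (x * g)) * relDiff (G x) (G (x * g)) ^ (2 * (n : ℕ))) := by
    have h1 : ∀ n : ℕ+, 2 * relDiffMean G μ (2 * (n : ℕ)) = ∑' x, ∑' g, μ g *
        ((G x + G (x * g)) * relDiff (G x) (G (x * g)) ^ (2 * (n : ℕ))) := fun n => by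
      have := relDiffMean_add (G := G) hsymm (fun _ => 1) (fun _ => rfl) (2 * (n : ℕ))
      simpa only [mul_one, relDiffMean] using this.symm
    simp_rw [hA, ← ENNReal.tsum_mul_left, mul_left_comm (2 : ℝ≥0∞), h1, ← ENNReal.tsum_mul_left]
    rw [ENNReal.tsum_comm]
    refine tsum_congr fun x => ?_
    rw [ENNReal.tsum_comm]
    refine tsum_congr fun g => tsum_congr fun n => ?_
    rw [mul_left_comm]
  have hmain : 2 * A + (entropy G + entropy G) = T + T := by
    nth_rewrite 1 [hH]
    nth_rewrite 2 [hT']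
    rw [hH', h2A, hT]
    simp_rw [← ENNReal.tsum_add]
    refine tsum_congr fun x => tsum_congr fun g => ?_
    rcases eq_or_ne (μ g) 0 with hg | hg
    · simp [hg]
    · rw [← mul_add, ← mul_add, ← mul_add, tsum_relDiff_add (PMF.coe_le_one _ _)
        (PMF.coe_le_one _ _) (hiff x g hg)]
  have : A + entropy G = T := by
    rw [← two_mul, ← two_mul, ← mul_add] at hmain
    exact (ENNReal.mul_right_inj two_ne_zero ENNReal.ofNat_ne_top).1 hmain
  rwa [this]

variable [MetricSpace Γ]

lemma dist_inv_one (hleft : ∀ a x y : Γ, dist (a * x) (a * y) = dist x y) (g : Γ) :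
    dist g⁻¹ 1 = dist g 1 := by
  have := hleft g g⁻¹ 1
  rwa [mul_inv_cancel, mul_one, dist_comm, eq_comm] at this

/-- Symmetrized, the mean increase of length is half the sum of `μ g (G x - G (x g)) (|x g| - |x|)`.
The last factor is at most `|g|` in absolute value, and `|G x - G (x g)| = (G x + G (x g)) *
relDiff`. -/
lemma meanLength_conv_le_add (hleft : ∀ a x y : Γ, dist (a * x) (a * y) = dist x y)
    {G μ : PMF Γ} (hsymm : ∀ g : Γ, μ g⁻¹ = μ g) :
    meanLength (conv G μ) ≤ meanLength G + ∑' x, ∑' g,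
      G x * μ g * relDiff (G x) (G (x * g)) * ENNReal.ofReal (dist g 1) := by
  set L : Γ → ℝ≥0∞ := fun x => ENNReal.ofReal (dist x 1) with hL
  have hE : meanLength (conv G μ) = ∑' x, ∑' g, μ g * (G x * L (x * g)) := by
    rw [meanLength_conv]
    exact tsum_congr fun x => tsum_congr fun g => by rw [hL]; ring
  have hE' : meanLength (conv G μ) = ∑' x, ∑' g, μ g * (G (x * g) * L x) := by
    rw [hE]
    exact tsum_step_swap hsymm (fun x y _ => G x * L y) (fun _ _ _ => rfl)
  have hD : meanLength G = ∑' x, ∑' g, μ g * (G x * L x) := by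
    rw [meanLength]
    refine tsum_congr fun x => ?_
    rw [ENNReal.tsum_mul_right, μ.tsum_coe, one_mul, mul_comm]
  have hD' : meanLength G = ∑' x, ∑' g, μ g * (G (x * g) * L (x * g)) := by
    rw [hD]
    exact tsum_step_swap hsymm (fun x y _ => G x * L x) (fun _ _ _ => rfl)
  have hC := relDiffMean_add (G := G) hsymm L (fun g => by simp only [hL, dist_inv_one hleft]) 1
  simp only [pow_one] at hC
  set C := ∑' x, ∑' g, G x * μ g * relDiff (G x) (G (x * g)) * L g with hCdef
  have hmain : meanLength (conv G μ) + meanLength (conv G μ) ≤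
      meanLength G + meanLength G + 2 * C := by
    nth_rewrite 1 [hE]
    nth_rewrite 1 [hD]
    rw [hE', hD', ← hC]
    simp_rw [← ENNReal.tsum_add]
    refine ENNReal.tsum_le_tsum fun x => ENNReal.tsum_le_tsum fun g => ?_
    rw [← mul_add, ← mul_add, ← mul_add]
    refine mul_le_mul_right ?_ (μ g)
    rw [add_mul_relDiff (G.apply_ne_top _) (G.apply_ne_top _)]
    have h1 := dist_mul_one_le hleft x g
    have h2 := dist_one_le hleft x g
    have e : ∀ z, G z = ENNReal.ofReal (G z).toReal := fun z =>
      (ENNReal.ofReal_toReal (G.apply_ne_top z)).symm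
    have hx : 0 ≤ (G x).toReal := ENNReal.toReal_nonneg
    have hy : 0 ≤ (G (x * g)).toReal := ENNReal.toReal_nonneg
    nth_rewrite 1 [e x]
    nth_rewrite 1 [e (x * g)]
    rw [e x, e (x * g), ENNReal.toReal_ofReal hx, ENNReal.toReal_ofReal hy]
    have d1 : 0 ≤ dist x 1 := dist_nonneg
    have d2 : 0 ≤ dist (x * g) 1 := dist_nonneg
    have d3 : 0 ≤ dist g 1 := dist_nonneg
    simp only [hL]
    rw [← ENNReal.ofReal_mul hx, ← ENNReal.ofReal_mul hx, ← ENNReal.ofReal_mul hy,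
      ← ENNReal.ofReal_mul hy, ← ENNReal.ofReal_mul (abs_nonneg _),
      ← ENNReal.ofReal_add (by positivity) (by positivity),
      ← ENNReal.ofReal_add (by positivity) (by positivity),
      ← ENNReal.ofReal_add (by positivity) (by positivity)]
    refine ENNReal.ofReal_le_ofReal ?_
    have habs : ((G x).toReal - (G (x * g)).toReal) * (dist (x * g) 1 - dist x 1) ≤
        |(G x).toReal - (G (x * g)).toReal| * dist g 1 := by
      refine (le_abs_self _).trans ?_
      rw [abs_mul]
      gcongr
      rw [abs_le]
      constructor <;> linarith
    linarith
  rw [← two_mul, ← two_mul, ← mul_add] at hmain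
  exact (ENNReal.mul_le_mul_iff_right two_ne_zero ENNReal.ofNat_ne_top).1 hmain

/-- Hölder's inequality for the law of a random step. -/
lemma tsum_relDiff_mul_dist_le (G μ : PMF Γ) (n : ℕ+) :
    (∑' x, ∑' g, G x * μ g * relDiff (G x) (G (x * g)) * ENNReal.ofReal (dist g 1)) ^
      (2 * (n : ℕ)) ≤ relDiffMean G μ (2 * (n : ℕ)) *
        pMoment (1 + 1 / (2 * (n : ℝ) - 1)) μ ^ (2 * (n : ℕ)) := by
  let _ : MeasurableSpace (Γ × Γ) := ⊤
  have hn1 : (1 : ℝ) ≤ (n : ℕ) := by exact Nat.one_le_cast.2 n.pos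
  set q : ℝ := 1 + 1 / (2 * (n : ℝ) - 1) with hq
  set r : ℝ := 2 * (n : ℕ) with hr
  have hr0 : 0 < r := by positivity
  have hr1 : 1 < r := by linarith
  have hqr : q.HolderConjugate r := by
    have : q = r / (r - 1) := by
      rw [hq]
      have : r - 1 ≠ 0 := by linarith
      field_simp
      ring
    rw [this]
    exact (Real.HolderConjugate.conjExponent hr1).symm
  have hq0 : 0 < q := hqr.pos
  -- The weight `w = G x * μ g` is split as `w ^ (1 / q) * w ^ (1 / r)`, so that counting measure
  -- suffices.
  have key := ENNReal.lintegral_mul_le_Lp_mul_Lq (MeasureTheory.Measure.count) hqr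
    (f := fun z : Γ × Γ => (G z.1 * μ z.2) ^ (1 / q) * ENNReal.ofReal (dist z.2 1))
    (g := fun z : Γ × Γ => (G z.1 * μ z.2) ^ (1 / r) * relDiff (G z.1) (G (z.1 * z.2)))
    measurable_from_top.aemeasurable measurable_from_top.aemeasurable
  simp only [MeasureTheory.lintegral_count, Pi.mul_apply] at key
  rw [ENNReal.tsum_prod', ENNReal.tsum_prod', ENNReal.tsum_prod'] at key
  have hw : ∀ w : ℝ≥0∞, w ^ (1 / q) * w ^ (1 / r) = w := fun w => by
    rw [← ENNReal.rpow_add_of_nonneg _ _ (by positivity) (by positivity), one_div, one_div,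
      hqr.inv_add_inv_eq_one, ENNReal.rpow_one]
  have e1 : ∀ x g, (G x * μ g) ^ (1 / q) * ENNReal.ofReal (dist g 1) *
      ((G x * μ g) ^ (1 / r) * relDiff (G x) (G (x * g))) =
      G x * μ g * relDiff (G x) (G (x * g)) * ENNReal.ofReal (dist g 1) := fun x g => by
    nth_rewrite 3 [← hw (G x * μ g)]
    ring
  have e2 : ∀ x g, ((G x * μ g) ^ (1 / q) * ENNReal.ofReal (dist g 1)) ^ q =
      G x * (ENNReal.ofReal (dist g 1 ^ q) * μ g) := fun x g => by
    rw [ENNReal.mul_rpow_of_nonneg _ _ hq0.le, ← ENNReal.rpow_mul, one_div_mul_cancel hq0.ne',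
      ENNReal.rpow_one, ENNReal.ofReal_rpow_of_nonneg dist_nonneg hq0.le]
    ring
  have e3 : ∀ x g, ((G x * μ g) ^ (1 / r) * relDiff (G x) (G (x * g))) ^ r =
      G x * μ g * relDiff (G x) (G (x * g)) ^ (2 * (n : ℕ)) := fun x g => by
    rw [ENNReal.mul_rpow_of_nonneg _ _ hr0.le, ← ENNReal.rpow_mul, one_div_mul_cancel hr0.ne',
      ENNReal.rpow_one, ← ENNReal.rpow_natCast]
    simp [hr]
  simp only [e1, e2, e3, ENNReal.tsum_mul_left, ENNReal.tsum_mul_right, G.tsum_coe,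
    one_mul] at key
  have hpow : ∀ w : ℝ≥0∞, (w ^ (1 / r)) ^ (2 * (n : ℕ)) = w := fun w => by
    rw [← ENNReal.rpow_natCast, ← ENNReal.rpow_mul]
    have : 1 / r * ((2 * (n : ℕ) : ℕ) : ℝ) = 1 := by
      push_cast
      rw [← hr, one_div_mul_cancel hr0.ne']
    rw [this, ENNReal.rpow_one]
  refine (pow_le_pow_left' key _).trans (le_of_eq ?_)
  rw [mul_pow, hpow, mul_comm]
  rfl

end Core

/-! ### The geometric time -/

section Geometric

/-- The geometric law on `ℕ` with weights `(1 - β) βⁿ`. -/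
noncomputable def geometricLaw (β : ℝ) (h0 : 0 ≤ β) (h1 : β < 1) : PMF ℕ :=
  ⟨fun n => ENNReal.ofReal (1 - β) * ENNReal.ofReal β ^ n, by
    have hsum : ∑' n : ℕ, ENNReal.ofReal (1 - β) * ENNReal.ofReal β ^ n = 1 := by
      rw [ENNReal.tsum_mul_left, ENNReal.tsum_geometric, ← ENNReal.ofReal_one,
        ← ENNReal.ofReal_sub _ h0, ENNReal.mul_inv_cancel _ ENNReal.ofReal_ne_top,
        ENNReal.ofReal_one]
      simpa using h1
    exact hsum ▸ ENNReal.summable.hasSum⟩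

variable {β : ℝ} {h0 : 0 ≤ β} {h1 : β < 1}

lemma geometricLaw_apply (n : ℕ) : geometricLaw β h0 h1 n =
    ENNReal.ofReal (1 - β) * ENNReal.ofReal β ^ n := rfl

lemma geometricLaw_succ (n : ℕ) : geometricLaw β h0 h1 (n + 1) =
    ENNReal.ofReal β * geometricLaw β h0 h1 n := by
  rw [geometricLaw_apply, geometricLaw_apply, pow_succ]
  ring

lemma tsum_geometricLaw_mul_nat :
    ∑' n : ℕ, geometricLaw β h0 h1 n * n = ENNReal.ofReal (β / (1 - β)) := by
  have h := (hasSum_coe_mul_geometric_of_norm_lt_one (r := β) (by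
    rwa [Real.norm_of_nonneg h0])).mul_left (1 - β)
  have h1' : 0 < 1 - β := sub_pos.2 h1
  rw [show (1 - β) * (β / (1 - β) ^ 2) = β / (1 - β) by field_simp] at h
  rw [← h.tsum_eq, ENNReal.ofReal_tsum_of_nonneg (fun n => by positivity) h.summable]
  refine tsum_congr fun n => ?_
  rw [geometricLaw_apply, ENNReal.ofReal_mul h1'.le, ENNReal.ofReal_mul n.cast_nonneg,
    ENNReal.ofReal_pow h0, ENNReal.ofReal_natCast]
  ring

lemma ofReal_one_sub_add (h0 : 0 ≤ β) (h1 : β < 1) :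
    ENNReal.ofReal (1 - β) + ENNReal.ofReal β = 1 := by
  rw [← ENNReal.ofReal_add (sub_pos.2 h1).le h0]
  simp

end Geometric

/-! ### The walk at a geometric time and the limit `β → 1` -/

section Mixture

variable {Γ : Type*} [Group Γ] {β : ℝ} {h0 : 0 ≤ β} {h1 : β < 1}

lemma conv_bind {α : Type*} (P : PMF α) (Q : α → PMF Γ) (μ : PMF Γ) :
    conv (P.bind Q) μ = P.bind fun n => conv (Q n) μ := by
  simp only [conv, PMF.bind_bind]

/-- The law of the random walk at an independent geometric time. -/
noncomputable def geometricWalk (β : ℝ) (h0 : 0 ≤ β) (h1 : β < 1) (μ : PMF Γ) : PMF Γ :=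
  (geometricLaw β h0 h1).bind (convPow μ)

/-- One further step shifts the geometric weights by a factor `β`; only the term of time `0` is
lost. -/
lemma mul_conv_geometricWalk_le (μ : PMF Γ) (y : Γ) :
    ENNReal.ofReal β * conv (geometricWalk β h0 h1 μ) μ y ≤ geometricWalk β h0 h1 μ y := by
  rw [geometricWalk, conv_bind, PMF.bind_apply, PMF.bind_apply,
    tsum_eq_zero_add' (f := fun n => geometricLaw β h0 h1 n * convPow μ n y) ENNReal.summable,
    ← ENNReal.tsum_mul_left]
  refine le_add_left (ENNReal.tsum_le_tsum fun n => ?_)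
  rw [geometricLaw_succ, mul_assoc, convPow_succ]

/-- Bounding `G` below by its `n`-th summand bounds its surprisal by those of the weight and of
`convPow μ n`. Averaging over `x` and `n` brings in the mean time `β / (1 - β)`. -/
lemma entropy_geometricWalk_le (hβ : 0 < β) (μ : PMF Γ) {K C : ℝ≥0∞}
    (hK : ∀ n : ℕ, entropy (convPow μ n) ≤ n * K + C) :
    entropy (geometricWalk β h0 h1 μ) ≤ surprisal (ENNReal.ofReal (1 - β)) + C +
      ENNReal.ofReal (β / (1 - β)) * (surprisal (ENNReal.ofReal β) + K) := by
  set G := geometricWalk β h0 h1 μ with hG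
  set a := ENNReal.ofReal (1 - β) with ha
  set b := ENNReal.ofReal β with hb
  have ha0 : a ≠ 0 := by simpa [ha] using h1
  have hb0 : b ≠ 0 := by simpa [hb] using hβ
  have hn : ∀ n : ℕ, ∑' x, convPow μ n x * surprisal (G x) ≤
      (surprisal a + C) + n * (surprisal b + K) := fun n => by
    calc ∑' x, convPow μ n x * surprisal (G x)
        ≤ ∑' x, (convPow μ n x * (surprisal a + n * surprisal b) +
            convPow μ n x * surprisal (convPow μ n x)) := by
          refine ENNReal.tsum_le_tsum fun x => ?_
          rcases eq_or_ne (convPow μ n x) 0 with hx | hx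
          · simp [hx]
          rw [← mul_add]
          gcongr
          have hle : a * b ^ n * convPow μ n x ≤ G x := by
            rw [hG, geometricWalk, PMF.bind_apply]
            exact ENNReal.le_tsum (f := fun n => geometricLaw β h0 h1 n * convPow μ n x) n
          have hbn : b ^ n ≠ 0 := pow_ne_zero _ hb0
          have hbn' : b ^ n ≠ ∞ := ENNReal.pow_ne_top ENNReal.ofReal_ne_top
          calc surprisal (G x) ≤ surprisal (a * b ^ n * convPow μ n x) :=
                surprisal_anti (mul_ne_zero (mul_ne_zero ha0 hbn) hx) hle (G.apply_ne_top x)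
            _ ≤ surprisal (a * b ^ n) + surprisal (convPow μ n x) :=
                surprisal_mul_le (mul_ne_zero ha0 hbn) hx
                  (ENNReal.mul_ne_top ENNReal.ofReal_ne_top hbn') (PMF.apply_ne_top _ _)
            _ ≤ surprisal a + n * surprisal b + surprisal (convPow μ n x) := by
                gcongr
                exact (surprisal_mul_le ha0 hbn ENNReal.ofReal_ne_top hbn').trans
                  (add_le_add_right (surprisal_pow_le n) _)
      _ = surprisal a + n * surprisal b + entropy (convPow μ n) := by
          rw [ENNReal.tsum_add, ENNReal.tsum_mul_right, PMF.tsum_coe, one_mul, entropy_eq_tsum]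
      _ ≤ surprisal a + n * surprisal b + (n * K + C) := by
          gcongr
          exact hK n
      _ = (surprisal a + C) + n * (surprisal b + K) := by ring
  calc entropy G = ∑' n, geometricLaw β h0 h1 n * ∑' x, convPow μ n x * surprisal (G x) := by
        rw [entropy_eq_tsum]
        exact tsum_bind_mul _ _ _
    _ ≤ ∑' n : ℕ, (geometricLaw β h0 h1 n * (surprisal a + C) +
          geometricLaw β h0 h1 n * n * (surprisal b + K)) := by
        refine ENNReal.tsum_le_tsum fun n => ?_
        rw [mul_assoc, ← mul_add]
        gcongr
        exact hn n
    _ = _ := by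
        rw [ENNReal.tsum_add, ENNReal.tsum_mul_right, ENNReal.tsum_mul_right, PMF.tsum_coe,
          one_mul, tsum_geometricLaw_mul_nat]

variable [MetricSpace Γ]

lemma meanLength_bind {α : Type*} (P : PMF α) (Q : α → PMF Γ) :
    meanLength (P.bind Q) = ∑' n, P n * meanLength (Q n) := by
  simp only [meanLength, mul_comm (ENNReal.ofReal _), tsum_bind_mul]

lemma meanLength_convPow_le (hleft : ∀ a x y : Γ, dist (a * x) (a * y) = dist x y)
    (μ : PMF Γ) (n : ℕ) : meanLength (convPow μ n) ≤ n * meanLength μ := by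
  induction n with
  | zero => simp [convPow, meanLength_pure_one]
  | succ n ih =>
    push_cast
    rw [add_mul, one_mul]
    exact (meanLength_conv_le hleft _ _).trans (add_le_add_left ih _)

lemma drift_le_tsum_geometricWalk (hleft : ∀ a x y : Γ, dist (a * x) (a * y) = dist x y)
    {μ : PMF Γ} (hsymm : ∀ g : Γ, μ g⁻¹ = μ g) (hmoment : meanLength μ ≠ ∞) :
    drift μ ≤ ∑' x, ∑' g, geometricWalk β h0 h1 μ x * μ g *
      relDiff (geometricWalk β h0 h1 μ x) (geometricWalk β h0 h1 μ (x * g)) *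
        ENNReal.ofReal (dist g 1) := by
  set G := geometricWalk β h0 h1 μ with hG
  have hstep := meanLength_conv_le_add hleft (G := G) hsymm
  set C := ∑' x, ∑' g, G x * μ g * relDiff (G x) (G (x * g)) * ENNReal.ofReal (dist g 1)
  have hE : meanLength (conv G μ) =
      ∑' n, geometricLaw β h0 h1 n * meanLength (convPow μ (n + 1)) := by
    rw [hG, geometricWalk, conv_bind, meanLength_bind]
    rfl
  have hD : meanLength G = ∑' n, geometricLaw β h0 h1 n * meanLength (convPow μ n) :=
    meanLength_bind _ _
  -- The walk has length `0` at time `0`, so here the shift of the weights loses nothing.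
  have hDE : meanLength G = ENNReal.ofReal β * meanLength (conv G μ) := by
    rw [hD, hE, tsum_eq_zero_add' ENNReal.summable, ← ENNReal.tsum_mul_left]
    simp only [geometricLaw_succ, convPow, meanLength_pure_one, mul_zero, zero_add, mul_assoc]
  have hDfin : meanLength G ≠ ∞ := by
    refine ne_top_of_le_ne_top ?_ (hD.le.trans (ENNReal.tsum_le_tsum fun n =>
      mul_le_mul_right (meanLength_convPow_le hleft μ n) _))
    simp_rw [← mul_assoc]
    rw [ENNReal.tsum_mul_right, tsum_geometricLaw_mul_nat]
    exact ENNReal.mul_ne_top ENNReal.ofReal_ne_top hmoment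
  have haE : ENNReal.ofReal (1 - β) * meanLength (conv G μ) ≤ C := by
    have h : ENNReal.ofReal (1 - β) * meanLength (conv G μ) + meanLength G ≤
        C + meanLength G := by
      nth_rewrite 1 [hDE]
      rw [← add_mul, ofReal_one_sub_add h0 h1, one_mul, add_comm C]
      exact hstep
    exact (ENNReal.add_le_add_iff_right hDfin).1 h
  refine le_trans ?_ haE
  -- This is `E|X_{N+1}| ≥ ℓ E(N + 1)`, and `E(N + 1) = 1 / (1 - β)`.
  have hlow : (ENNReal.ofReal (β / (1 - β)) + 1) * drift μ ≤ meanLength (conv G μ) := by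
    have hone : ∑' n, geometricLaw β h0 h1 n = 1 := PMF.tsum_coe _
    rw [hE, ← tsum_geometricLaw_mul_nat (h0 := h0) (h1 := h1), ← hone, ← ENNReal.tsum_add,
      ← ENNReal.tsum_mul_right]
    refine ENNReal.tsum_le_tsum fun n => ?_
    have h := (drift_spec hleft hmoment).2.2 (n + 1)
    push_cast at h
    rw [← mul_add_one, mul_assoc]
    gcongr
  refine le_trans (le_of_eq ?_) (mul_le_mul_right hlow _)
  have h1' : 0 < 1 - β := sub_pos.2 h1
  rw [← mul_assoc, ← ENNReal.ofReal_one, ← ENNReal.ofReal_add (by positivity) zero_le_one,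
    ← ENNReal.ofReal_mul h1'.le]
  rw [show (1 - β) * (β / (1 - β) + 1) = 1 by field_simp; ring, ENNReal.ofReal_one, one_mul]

lemma driftSeries_le_tsum_relDiffMean {G μ : PMF Γ}
    (h : drift μ ≤ ∑' x, ∑' g, G x * μ g * relDiff (G x) (G (x * g)) *
      ENNReal.ofReal (dist g 1)) :
    driftSeries μ ≤
      ∑' n : ℕ+, ENNReal.ofReal (2 / (2 * (n : ℝ) - 1)) * relDiffMean G μ (2 * (n : ℕ)) := by
  refine ENNReal.tsum_le_tsum fun n => ?_
  gcongr
  rw [div_eq_mul_inv, mul_pow, ← ENNReal.inv_pow, ← div_eq_mul_inv]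
  exact ENNReal.div_le_of_le_mul
    ((pow_le_pow_left' h _).trans (tsum_relDiff_mul_dist_le G μ n))

lemma mul_driftSeries_le (hleft : ∀ a x y : Γ, dist (a * x) (a * y) = dist x y)
    {μ : PMF Γ} (hsymm : ∀ g : Γ, μ g⁻¹ = μ g) (hmoment : meanLength μ ≠ ∞)
    {K C : ℝ≥0∞} (hKt : K ≠ ∞) (hCt : C ≠ ∞)
    (hK : ∀ n : ℕ, entropy (convPow μ n) ≤ n * K + C) {β : ℝ} (h0 : 0 < β) (h1 : β < 1) :
    ENNReal.ofReal β * driftSeries μ ≤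
      ENNReal.ofReal (Real.negMulLog (1 - β)) + ENNReal.ofReal (1 - β) * C +
        ENNReal.ofReal β * (ENNReal.ofReal (-Real.log β) + K) := by
  set G := geometricWalk β h0.le h1 μ with hG
  have hH := entropy_geometricWalk_le (h0 := h0.le) (h1 := h1) h0 μ hK
  have hF := driftSeries_le_tsum_relDiffMean
    (drift_le_tsum_geometricWalk (h0 := h0.le) (h1 := h1) hleft hsymm hmoment)
  have hb0 : ENNReal.ofReal β ≠ 0 := by simpa using h0
  have hA := tsum_relDiffMean_le (G := G) hsymm hb0 (mul_conv_geometricWalk_le μ)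
  have hHt : entropy G ≠ ∞ := by
    refine ne_top_of_le_ne_top ?_ hH
    simp [surprisal_ne_top, hKt, hCt, ENNReal.mul_ne_top]
  -- Finiteness of `entropy G` allows `β * entropy G` to be cancelled.
  have hmain : ENNReal.ofReal β * driftSeries μ ≤ ENNReal.ofReal (1 - β) * entropy G := by
    have h : ENNReal.ofReal β * driftSeries μ + ENNReal.ofReal β * entropy G ≤
        ENNReal.ofReal (1 - β) * entropy G + ENNReal.ofReal β * entropy G := by
      rw [← mul_add, ← add_mul, ofReal_one_sub_add h0.le h1, one_mul]
      exact le_trans (by gcongr) hA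
    exact (ENNReal.add_le_add_iff_right
      (ENNReal.mul_ne_top ENNReal.ofReal_ne_top hHt)).1 h
  have h1' : 0 < 1 - β := sub_pos.2 h1
  refine hmain.trans ((mul_le_mul_right hH _).trans (le_of_eq ?_))
  rw [mul_add, mul_add, ← mul_assoc, ← ENNReal.ofReal_mul h1'.le, mul_div_cancel₀ _ h1'.ne',
    surprisal, surprisal, ENNReal.toReal_ofReal h1'.le, ENNReal.toReal_ofReal h0.le,
    ← ENNReal.ofReal_mul h1'.le, Real.negMulLog, neg_mul_comm]

lemma driftSeries_le_asympEntropy (hleft : ∀ a x y : Γ, dist (a * x) (a * y) = dist x y)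
    {μ : PMF Γ} (hsymm : ∀ g : Γ, μ g⁻¹ = μ g) (hmoment : meanLength μ ≠ ∞) :
    driftSeries μ ≤ asympEntropy μ := by
  by_cases hent : entropy μ = ∞
  · rw [(asympEntropy_of_entropy_eq_top hent).2]
    exact le_top
  refine le_of_forall_gt_imp_ge_of_dense fun K hK => ?_
  rcases eq_or_ne K ∞ with rfl | hKt
  · exact le_top
  obtain ⟨N, hN⟩ := eventually_atTop.1 ((tendsto_asympEntropy μ).eventually_lt_const hK)
  -- The constant absorbs the finitely many times at which `entropy (convPow μ n) / n < K` may fail;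
  -- its factor `1 - β` removes it in the limit.
  set C : ℝ≥0∞ := ∑ n ∈ Finset.range (N + 1), entropy (convPow μ n) with hC
  have hCt : C ≠ ∞ := (ENNReal.sum_lt_top.2 fun n _ =>
    (entropy_convPow_ne_top hent n).lt_top).ne
  have hKC : ∀ n : ℕ, entropy (convPow μ n) ≤ n * K + C := fun n => by
    by_cases hn : n < N + 1
    · exact le_add_left (Finset.single_le_sum (f := fun n => entropy (convPow μ n))
        (fun _ _ => zero_le) (Finset.mem_range.2 hn))
    · have hn0 : (n : ℝ≥0∞) ≠ 0 := by
        have : n ≠ 0 := by omega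
        exact_mod_cast this
      have := (ENNReal.div_le_iff hn0 (ENNReal.natCast_ne_top n)).1 (hN n (by omega)).le
      rw [mul_comm] at this
      exact this.trans le_self_add
  have hlim : Tendsto (fun β : ℝ => ENNReal.ofReal (Real.negMulLog (1 - β)) +
      ENNReal.ofReal (1 - β) * C + ENNReal.ofReal β * (ENNReal.ofReal (-Real.log β) + K))
      (𝓝[<] 1) (𝓝 K) := by
    have t1 : Tendsto (fun β : ℝ => ENNReal.ofReal (Real.negMulLog (1 - β))) (𝓝[<] 1) (𝓝 0) := by
      have : Continuous fun β : ℝ => ENNReal.ofReal (Real.negMulLog (1 - β)) :=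
        ENNReal.continuous_ofReal.comp
          (Real.continuous_negMulLog.comp (continuous_const.sub continuous_id))
      simpa using (this.tendsto 1).mono_left nhdsWithin_le_nhds
    have t2 : Tendsto (fun β : ℝ => ENNReal.ofReal (1 - β)) (𝓝[<] 1) (𝓝 0) := by
      have : Continuous fun β : ℝ => ENNReal.ofReal (1 - β) :=
        ENNReal.continuous_ofReal.comp (continuous_const.sub continuous_id)
      simpa using (this.tendsto 1).mono_left nhdsWithin_le_nhds
    have t3 : Tendsto (fun β : ℝ => ENNReal.ofReal β) (𝓝[<] 1) (𝓝 1) := by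
      simpa using (ENNReal.continuous_ofReal.tendsto 1).mono_left nhdsWithin_le_nhds
    have t4 : Tendsto (fun β : ℝ => ENNReal.ofReal (-Real.log β)) (𝓝[<] 1) (𝓝 0) := by
      have := ENNReal.tendsto_ofReal ((Real.continuousAt_log one_ne_zero).tendsto.neg)
      simpa using this.mono_left nhdsWithin_le_nhds
    have t5 := (t1.add (ENNReal.Tendsto.mul_const t2 (Or.inr hCt))).add
      (ENNReal.Tendsto.mul t3 (Or.inr (by simpa using hKt)) (t4.add_const K)
        (Or.inr ENNReal.one_ne_top))
    simpa using t5
  have hlim' : Tendsto (fun β : ℝ => ENNReal.ofReal β * driftSeries μ) (𝓝[<] 1)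
      (𝓝 (driftSeries μ)) := by
    have t3 : Tendsto (fun β : ℝ => ENNReal.ofReal β) (𝓝[<] 1) (𝓝 1) := by
      simpa using (ENNReal.continuous_ofReal.tendsto 1).mono_left nhdsWithin_le_nhds
    simpa using ENNReal.Tendsto.mul_const (b := driftSeries μ) t3 (Or.inl one_ne_zero)
  refine le_of_tendsto_of_tendsto hlim' hlim ?_
  filter_upwards [Ioo_mem_nhdsLT (zero_lt_one (α := ℝ))] with β hβ
  exact mul_driftSeries_le hleft hsymm hmoment hKt hCt hKC hβ.1 hβ.2

end Mixture

/-! ### Comparison with the second moment -/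

section SecondMoment

variable {Γ : Type*} [Group Γ] [MetricSpace Γ]

lemma pMoment_one (μ : PMF Γ) : pMoment 1 μ = meanLength μ := by
  simp [pMoment, meanLength]

lemma pMoment_mono [Countable Γ] (μ : PMF Γ) {p q : ℝ} (hp : 0 < p) (hpq : p ≤ q) :
    pMoment p μ ≤ pMoment q μ := by
  let _ : MeasurableSpace Γ := ⊤
  have e : ∀ r : ℝ, 0 < r → pMoment r μ =
      MeasureTheory.eLpNorm' (fun g : Γ => dist g 1) r μ.toMeasure := fun r hr => by
    rw [pMoment, MeasureTheory.eLpNorm', MeasureTheory.lintegral_countable']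
    congr 1
    refine tsum_congr fun g => ?_
    rw [PMF.toMeasure_apply_singleton _ _ (MeasurableSet.singleton g),
      Real.enorm_of_nonneg dist_nonneg, ENNReal.ofReal_rpow_of_nonneg dist_nonneg hr.le]
  rw [e p hp, e q (hp.trans_le hpq)]
  exact MeasureTheory.eLpNorm'_le_eLpNorm'_of_exponent_le hp hpq _
    measurable_from_top.aestronglyMeasurable

/-- By symmetry a step `g` of positive length can be followed by `g⁻¹`, so the triangle inequality
is strict on average already for two steps, while `2 ℓ ≤ E|X_2|`. -/
lemma drift_lt_meanLength (hleft : ∀ a x y : Γ, dist (a * x) (a * y) = dist x y)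
    {μ : PMF Γ} (hsymm : ∀ g : Γ, μ g⁻¹ = μ g) (hmoment : meanLength μ ≠ ∞)
    (h0 : meanLength μ ≠ 0) : drift μ < meanLength μ := by
  obtain ⟨g, hg⟩ : ∃ g, ENNReal.ofReal (dist g 1) * μ g ≠ 0 := by
    by_contra! h
    exact h0 (ENNReal.tsum_eq_zero.2 h)
  have hsum : meanLength μ + meanLength μ = ∑' z : Γ × Γ, μ z.1 * μ z.2 *
      (ENNReal.ofReal (dist z.1 1) + ENNReal.ofReal (dist z.2 1)) := by
    rw [ENNReal.tsum_prod']
    simp_rw [mul_add, ENNReal.tsum_add, mul_assoc, ENNReal.tsum_mul_left, ENNReal.tsum_mul_right,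
      μ.tsum_coe, one_mul, meanLength, mul_comm (μ _)]
  have h2 : meanLength (convPow μ 2) = ∑' z : Γ × Γ, μ z.1 * μ z.2 *
      ENNReal.ofReal (dist (z.1 * z.2) 1) := by
    rw [convPow_succ, convPow_one, meanLength_conv, ENNReal.tsum_prod']
  have hlt : meanLength (convPow μ 2) < meanLength μ + meanLength μ := by
    rw [hsum, h2]
    refine ENNReal.tsum_lt_tsum (i := (g, g⁻¹)) ?_ (fun z => ?_) ?_
    · rw [← h2]
      exact meanLength_convPow_ne_top hleft hmoment 2
    · rw [← ENNReal.ofReal_add dist_nonneg dist_nonneg]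
      gcongr
      exact dist_mul_one_le hleft _ _
    · simp only [mul_inv_cancel, dist_self, ENNReal.ofReal_zero, mul_zero, hsymm]
      have h1 := left_ne_zero_of_mul hg
      have h2 := right_ne_zero_of_mul hg
      exact pos_iff_ne_zero.2 (mul_ne_zero (mul_ne_zero h2 h2) fun h => h1 (add_eq_zero.1 h).1)
  have hle := (drift_spec hleft hmoment).2.2 2
  have : 2 * drift μ < 2 * meanLength μ := by
    rw [two_mul (meanLength μ)]
    exact lt_of_le_of_lt (by exact_mod_cast hle) hlt
  exact lt_of_mul_lt_mul_left' this

lemma drift_div_lt_one [Countable Γ] (hleft : ∀ a x y : Γ, dist (a * x) (a * y) = dist x y)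
    {μ : PMF Γ} (hsymm : ∀ g : Γ, μ g⁻¹ = μ g) (hmoment : meanLength μ ≠ ∞) :
    drift μ / pMoment 2 μ < 1 := by
  rcases eq_or_ne (meanLength μ) 0 with h0 | h0
  · have h := (drift_spec hleft hmoment).2.2 1
    rw [convPow_one, h0, Nat.cast_one, one_mul, nonpos_iff_eq_zero] at h
    simp [h]
  · refine ENNReal.div_lt_of_lt_mul ?_
    rw [one_mul]
    refine (drift_lt_meanLength hleft hsymm hmoment h0).trans_le ?_
    rw [← pMoment_one]
    exact pMoment_mono μ one_pos one_le_two

/-- The two series compare term by term: `1 + 1 / (2n - 1) ≤ 2`, and moments increase with the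
exponent. -/
lemma artanh_le_driftSeries [Countable Γ] {μ : PMF Γ} (h : drift μ / pMoment 2 μ < 1) :
    ENNReal.ofReal (2 * (drift μ / pMoment 2 μ).toReal *
      Real.artanh (drift μ / pMoment 2 μ).toReal) ≤ driftSeries μ := by
  have ht : drift μ / pMoment 2 μ ≠ ∞ := (h.trans ENNReal.one_lt_top).ne
  set x := (drift μ / pMoment 2 μ).toReal with hx
  have hx0 : 0 ≤ x := ENNReal.toReal_nonneg
  have hx1 : x < 1 := by
    have := (ENNReal.toReal_lt_toReal ht ENNReal.one_ne_top).2 h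
    rwa [ENNReal.toReal_one] at this
  have e : 2 * x * Real.artanh x = x * (Real.log (1 + x) - Real.log (1 - x)) := by
    rw [Real.artanh_eq_half_log ⟨by linarith, hx1.le⟩,
      Real.log_div (by linarith) (by linarith)]
    ring
  rw [e, ← tsum_mul_pow_eq hx0 hx1, hx, ENNReal.ofReal_toReal ht]
  refine ENNReal.tsum_le_tsum fun n => ?_
  have hn1 : (1 : ℝ) ≤ (n : ℕ) := Nat.one_le_cast.2 n.pos
  have hd : 0 < 2 * (n : ℝ) - 1 := by linarith
  gcongr
  refine pMoment_mono μ (by positivity) ?_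
  have : 1 / (2 * (n : ℝ) - 1) ≤ 1 := by
    rw [div_le_one hd]
    linarith
  linarith

end SecondMoment

end GroupWalk

theorem mainTheorem4 {Γ : Type*} [Group Γ] [Countable Γ] [MetricSpace Γ]
    (hleft : ∀ a x y : Γ, dist (a * x) (a * y) = dist x y)
    (hproper : ∀ r : ℝ, (Metric.closedBall (1 : Γ) r).Finite)
    (μ : PMF Γ) (hsymm : ∀ g : Γ, μ g⁻¹ = μ g)
    (hmoment : GroupWalk.meanLength μ ≠ ∞) :
    -- the drift and the asymptotic entropy exist as limits, and the drift is finite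
    Tendsto (fun n : ℕ => GroupWalk.meanLength (GroupWalk.convPow μ n) / (n : ℝ≥0∞)) atTop
      (𝓝 (GroupWalk.drift μ)) ∧
    GroupWalk.drift μ ≠ ∞ ∧
    Tendsto (fun n : ℕ => GroupWalk.entropy (GroupWalk.convPow μ n) / (n : ℝ≥0∞)) atTop
      (𝓝 (GroupWalk.asympEntropy μ)) ∧
    -- the inequality
    GroupWalk.driftSeries μ ≤ GroupWalk.asympEntropy μ ∧
    -- for a finite second moment the left side dominates `2 x artanh x`, where `x = ℓ / M₂(μ)`
    (GroupWalk.pMoment 2 μ ≠ ∞ →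
      (GroupWalk.drift μ / GroupWalk.pMoment 2 μ).toReal < 1 ∧
      ENNReal.ofReal (2 * (GroupWalk.drift μ / GroupWalk.pMoment 2 μ).toReal *
          Real.artanh (GroupWalk.drift μ / GroupWalk.pMoment 2 μ).toReal) ≤
        GroupWalk.driftSeries μ) := by
  have hspec := GroupWalk.drift_spec hleft hmoment
  have hlt := GroupWalk.drift_div_lt_one hleft hsymm hmoment
  refine ⟨hspec.2.1, hspec.1, GroupWalk.tendsto_asympEntropy μ,
    GroupWalk.driftSeries_le_asympEntropy hleft hsymm hmoment, fun _ =>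
    ⟨?_, GroupWalk.artanh_le_driftSeries hlt⟩⟩
  have := (ENNReal.toReal_lt_toReal (hlt.trans ENNReal.one_lt_top).ne ENNReal.one_ne_top).2 hlt
  rwa [ENNReal.toReal_one] at this
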